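/- Let $d\ge 2$ be an integer and $\ell>0$ a real number with either $\ell<d$, or $\ell>d$ and $d\in\{2,3\}$. For $r>1$ set $$\Delta=(w-1)^2-\sigma^2,\qquad \Delta_1=w(w-1)(w-r)-d(w-w_e)\sigma^2,\qquad w_e=\frac{\ell(r-1)}{d},$$ $$\Delta_2=\frac{\sigma}{\ell}\left[(\ell+d-1)w^2-w(\ell+d+\ell r-r)+\ell r-\ell\sigma^2\right],$$ and let $$r_\infty(d,\ell)=\begin{cases} r^*(d,\ell)=\dfrac{d+\ell}{\ell+\sqrt d}, & \ell<d,\\[2mm] r_+(d,\ell)=1+\dfrac{d-1}{(1+\sqrt\ell)^2}, & \ell>d.\end{cases}$$ Let $P_2=(\sigma(P_2),w(P_2))=(1-w_-,w_-)$, where $$w_-=\frac{dw_e+d-1-\frac{dw_e}{\ell}-\sqrt J}{2(d-1)},\qquad J=\Big(dw_e+d-1-\frac{dw_e}{\ell}\Big)^2-4d(d-1)w_e ,$$ and let $P_6$ be the point $(\sigma,w)=(+\infty,w_e)$ at infinity. A $P_6$–$P_2$ trajectory is a pair of real functions $(\sigma(x),w(x))$ on an interval $(-\infty,x_2]$ with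 $x_2\in\mathbb R$, differentiable and solving $$\Delta\, w'=-\Delta_1,\qquad \Delta\,\sigma'=-\Delta_2\qquad\Big({}'=\frac{d}{dx}\Big)$$ for $x<x_2$, such that $\sigma(x)\to+\infty$ and $w(x)\to w_e$ as $x\to-\infty$, continuous at $x_2$ from the left, with $(\sigma,w)(x_2)=P_2$ and $(\sigma,w)(x)\neq P_2$ for $x<x_2$. (These are the points of the trajectory with $\sigma\ge\sigma(P_2)$, i.e. inside the light cone.) Then there exists $\varepsilon=\varepsilon(d,\ell)>0$ such that for every $r$ with $r_\infty(d,\ell)-\varepsilon<r<r_\infty(d,\ell)$ there exists $c_r>0$ such that every $P_6$–$P_2$ trajectory has derivatives $\sigma'(x),w'(x)$ at every $x\le x_2$ (left derivatives at $x=x_2$) and, with $F=\sigma+\sigma'$, satisfies for all $x\le x_2$ $$(1-w-w')^2-F^2\ge c_r,\qquad 1-w-w'-\frac{(1-w)F}{\sigma}\ge c_r,\qquad 1-w-w'\ge c_r .$$ -/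

import Mathlib

open Set Filter Topology

noncomputable section

/-- The polynomial `Δ = (w - 1)² - σ²`, vanishing on the sonic lines. -/
def Delta (σ w : ℝ) : ℝ := (w - 1) ^ 2 - σ ^ 2

/-- `w_e = ℓ (r - 1) / d`, the `w`-coordinate of the point `P₆ = (σ = +∞, w = w_e)`. -/
def wE (d ℓ r : ℝ) : ℝ := ℓ * (r - 1) / d

/-- The polynomial `Δ₁ = w (w - 1) (w - r) - d (w - w_e) σ²`. -/
def Delta1 (d ℓ r σ w : ℝ) : ℝ :=
  w * (w - 1) * (w - r) - d * (w - wE d ℓ r) * σ ^ 2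

/-- The polynomial
`Δ₂ = (σ / ℓ) [(ℓ + d - 1) w² - w (ℓ + d + ℓ r - r) + ℓ r - ℓ σ²]`. -/
def Delta2 (d ℓ r σ w : ℝ) : ℝ :=
  σ / ℓ * ((ℓ + d - 1) * w ^ 2 - w * (ℓ + d + ℓ * r - r) + ℓ * r - ℓ * σ ^ 2)

/-- The critical speed `r*(d, ℓ) = (d + ℓ) / (ℓ + √d)`. -/
def rStar (d ℓ : ℝ) : ℝ := (d + ℓ) / (ℓ + √d)

/-- The critical speed `r₊(d, ℓ) = 1 + (d - 1) / (1 + √ℓ)²`. -/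
def rPlus (d ℓ : ℝ) : ℝ := 1 + (d - 1) / (1 + √ℓ) ^ 2

/-- The limiting speed: `r*(d, ℓ)` for `ℓ < d` and `r₊(d, ℓ)` for `ℓ > d`. -/
def rInf (d ℓ : ℝ) : ℝ := if ℓ < d then rStar d ℓ else rPlus d ℓ

/-- The discriminant `J` of the quadratic
`(d - 1) w² - (d w_e + d - 1 - d w_e / ℓ) w + d w_e`, whose roots are the `w`-coordinates of the
points with `σ ≠ 0` on the sonic line `w + σ = 1` at which `Δ = Δ₁ = Δ₂ = 0`. -/
def discJ (d ℓ r : ℝ) : ℝ :=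
  (d * wE d ℓ r + d - 1 - d * wE d ℓ r / ℓ) ^ 2 - 4 * d * (d - 1) * wE d ℓ r

/-- The `w`-coordinate `w_-` of `P₂`: the smaller root of the above quadratic. -/
def wP2 (d ℓ r : ℝ) : ℝ :=
  (d * wE d ℓ r + d - 1 - d * wE d ℓ r / ℓ - √(discJ d ℓ r)) / (2 * (d - 1))

/-- The `σ`-coordinate of `P₂ = (1 - w_-, w_-)`. -/
def sigmaP2 (d ℓ r : ℝ) : ℝ := 1 - wP2 d ℓ r

/-- `(σ, w)`, restricted to `(-∞, x₂]`, is a trajectory of `Δ w' = -Δ₁`, `Δ σ' = -Δ₂` that emanates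
from `P₆ = (+∞, w_e)` at `x = -∞` and reaches `P₂` (for the first time) at `x = x₂`. -/
structure IsP6P2Trajectory (d ℓ r : ℝ) (σ w : ℝ → ℝ) (x₂ : ℝ) : Prop where
  differentiableAt_σ : ∀ x < x₂, DifferentiableAt ℝ σ x
  differentiableAt_w : ∀ x < x₂, DifferentiableAt ℝ w x
  ode_w : ∀ x < x₂, Delta (σ x) (w x) * deriv w x = -Delta1 d ℓ r (σ x) (w x)
  ode_σ : ∀ x < x₂, Delta (σ x) (w x) * deriv σ x = -Delta2 d ℓ r (σ x) (w x)
  tendsto_σ : Tendsto σ atBot atTop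
  tendsto_w : Tendsto w atBot (𝓝 (wE d ℓ r))
  continuousWithinAt_σ : ContinuousWithinAt σ (Iic x₂) x₂
  continuousWithinAt_w : ContinuousWithinAt w (Iic x₂) x₂
  σ_end : σ x₂ = sigmaP2 d ℓ r
  w_end : w x₂ = wP2 d ℓ r
  first_hit : ∀ x < x₂, ¬ (σ x = sigmaP2 d ℓ r ∧ w x = wP2 d ℓ r)

end

/-!
Write `u = 1 - w`, `e = d (w - w_e)`, and let `q(w) = (d - 1) (w - w_-) (w - w_+)` be the quadratic
whose roots are the `w`-coordinates of the triple points on the sonic line `σ = u`. In terms of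
`T = q(w) / (σ² - u²)` the system becomes
`w' = -e + u T`, `σ' = σ (T / ℓ - 1)`,
so `F = σ + σ' = σ T / ℓ` and `H := 1 - w - w' - F = u + e - (u + σ / ℓ) T`.

A trajectory from `P₆` is confined to `w_e ≤ w < w_-`, `σ > u`, where `T > 0`
(`IsP6P2Trajectory.depth_pos_and_w_lt`, `IsP6P2Trajectory.excess_nonneg`). Hence `F > 0`, and all
three inequalities follow from a lower bound `H ≥ c > 0` (`repulsivity_of_gap`).

The bound comes from a barrier: in this region the flow crosses `H = 0` upwards. This is an explicit
inequality (`barrier_ineq`, `Admissible.gapRate_pos`), which rests on the position of `w_-` to the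
left of the solution `w` of `d (w - w_e) = ℓ (1 - w)`, that is, on `P₂` being a node. It degenerates
at `P₂`, where `T` is of the form `0 / 0`; taking `T` as a third coordinate resolves the point, and
the crossing there has the sign of the node condition (`Admissible.gapRate_pos_end`). A compactness
argument then gives a level `c`, independent of the trajectory, that is also crossed upwards
(`Admissible.exists_gap_level`). As `H` is large enough far out, it stays above `c`.

Finally `T` solves a Riccati equation with the singular factor `1 / (σ² - u²)`, not integrable at
the endpoint. Its bounded nonnegative solutions converge to the positive equilibrium
(`tendsto_pos_root`), so the left derivatives at `P₂` exist and the inequalities pass to the limit.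

Nothing here needs `r` to be close to the limiting speed: every `r` in `(1, r_∞)` is admissible
(`admissible_of_lt_rStar`, `admissible_of_lt_rPlus`).
-/

open Set Filter Topology

noncomputable section

/-! ### The algebra of the barrier -/

/-- The inequality behind the barrier. In the application `u = 1 - w`, `a = W - w`, `V = σ - u`,
`e = d (w - w_e)`, `E = u + e`, `q = q(w)`, and `hΓ` says that the point lies on the curve `H = 0`.
On that curve, up to the positive factor `h = ℓ u + σ`, the velocity `w'` is
`u (ℓ u - e) - e V`, the first factor on the right; `1 / a + (d - 1) a / q` is `-q'(w) / q(w)`. -/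
theorem barrier_ineq {d ℓ a u V e q E h s : ℝ} (hd : 2 ≤ d) (hℓ : 0 < ℓ) (ha : 0 < a)
    (hu : a < u) (hV : 0 < V) (he : 0 ≤ e) (hm : (ℓ + d) * a < ℓ * u - e)
    (hE : E = u + e) (hh : h = (ℓ + 1) * u + V) (hs : s = 2 * u + V)
    (hq : 0 < q) (hqu : q < (d - 1) * (a * u)) (hΓ : h * q = ℓ * E * V * s) :
    (ℓ + 1) * u + V * (h / s) <
      (u * (ℓ * u - e) - e * V) *
        (1 / a + (d - 1) * a / q + (d - 1) / E + (ℓ - 1) * V / (h * s)) := by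
  have hu0 : 0 < u := ha.trans hu
  have hE0 : 0 < E := by rw [hE]; positivity
  have hs0 : 0 < s := by rw [hs]; positivity
  have hh0 : 0 < h := by rw [hh]; positivity
  have hd1 : 0 < d - 1 := by linarith
  obtain ⟨ω, hω⟩ : ∃ ω, ω = h / s := ⟨_, rfl⟩
  have hω0 : 0 < ω := by rw [hω]; positivity
  have hωs : h = ω * s := by rw [hω]; field_simp
  have hVq : ℓ * E * V = ω * q := by
    have : s * (ℓ * E * V) = s * (ω * q) := by
      rw [show s * (ω * q) = ω * s * q by ring, ← hωs]; linarith
    exact mul_left_cancel₀ hs0.ne' this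
  have haℓ : d * a < ℓ * u := by linarith [mul_pos hℓ ha]
  have hda : 0 < (d - 1) * a := mul_pos hd1 ha
  have hk : 0 < (d - 1) * (a * u) := mul_pos hd1 (mul_pos ha hu0)
  -- `e < ℓ u` gives `e / E < ℓ / (ℓ + 1)`
  have heE : (ℓ + 1) * e ≤ ℓ * E := by rw [hE]; linarith [mul_pos hℓ ha]
  have heV : (ℓ + 1) * (e * V) ≤ ω * q := by
    rw [← hVq]; linarith [mul_le_mul_of_nonneg_right heE hV.le]
  have hqω : ω * q < ω * ((d - 1) * (a * u)) := mul_lt_mul_of_pos_left hqu hω0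
  obtain ⟨p, hp⟩ : ∃ p, p = u * (ℓ * u - e) - e * V := ⟨_, rfl⟩
  have hp1 : u * a * (ℓ + d) - ω * ((d - 1) * (a * u)) / (ℓ + 1) < p := by
    have h1 : e * V ≤ ω * q / (ℓ + 1) := by rw [le_div_iff₀ (by positivity)]; linarith
    have h2 : ω * q / (ℓ + 1) < ω * ((d - 1) * (a * u)) / (ℓ + 1) := by gcongr
    have h3 : u * ((ℓ + d) * a) < u * (ℓ * u - e) := mul_lt_mul_of_pos_left hm hu0
    rw [hp]; linarith
  have hVω : V * ω < ω ^ 2 * ((d - 1) * (a * u)) / (ℓ * E) := by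
    rw [lt_div_iff₀ (by positivity)]
    have h1 : ℓ * E * V * ω = ω * q * ω := by rw [hVq]
    linarith [mul_lt_mul_of_pos_left hqω hω0]
  rw [← hω, ← hp]
  -- It remains to compare `p / a` with `(ℓ + 1) u`, and the rest of the right side with `V ω`; here
  -- `ω = h / s` lies between `1` and `(ℓ + 1) / 2`.
  have hq' : 0 < (d - 1) * a / q := by positivity
  rcases le_or_gt 1 ℓ with h1 | h1
  · have hω1 : ω ≤ (ℓ + 1) / 2 := by
      rw [hω, div_le_iff₀ hs0, hh, hs]; linarith [mul_nonneg (sub_nonneg.2 h1) hV.le]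
    have hpa : u * a * (ℓ + 1) < p := by
      have h2 : ω * ((d - 1) * (a * u)) / (ℓ + 1) ≤ (d - 1) * (a * u) := by
        rw [div_le_iff₀ (by positivity), mul_comm]
        gcongr
        linarith
      have h3 : u * a * (ℓ + d) = u * a * (ℓ + 1) + (d - 1) * (a * u) := by ring
      linarith
    have hp0 : 0 < p := lt_trans (by positivity) hpa
    have h3 : 0 ≤ (ℓ - 1) * V / (h * s) :=
      div_nonneg (mul_nonneg (by linarith) hV.le) (by positivity)
    have h4 : p * (1 / a + (d - 1) / E) <
        p * (1 / a + (d - 1) * a / q + (d - 1) / E + (ℓ - 1) * V / (h * s)) :=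
      mul_lt_mul_of_pos_left (by linarith) hp0
    refine lt_of_le_of_lt ?_ h4
    have h5 : u * (ℓ + 1) ≤ p * (1 / a) := by
      rw [mul_one_div, le_div_iff₀ ha]; linarith
    have h6 : ω ^ 2 * ((d - 1) * (a * u)) / (ℓ * E) ≤ p * ((d - 1) / E) := by
      rw [div_le_iff₀ (by positivity),
        show p * ((d - 1) / E) * (ℓ * E) = ℓ * p * (d - 1) by field_simp]
      have h7 : ω ^ 2 ≤ ℓ * (ℓ + 1) := by
        have h8 : ω ^ 2 ≤ ((ℓ + 1) / 2) ^ 2 := by gcongr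
        have h9 : 0 ≤ (ℓ + 1) * (3 * ℓ - 1) := mul_nonneg (by linarith) (by linarith)
        linarith
      calc ω ^ 2 * ((d - 1) * (a * u)) ≤ ℓ * (ℓ + 1) * ((d - 1) * (a * u)) := by gcongr
        _ = ℓ * (u * a * (ℓ + 1)) * (d - 1) := by ring
        _ ≤ ℓ * p * (d - 1) := by gcongr
    linarith [mul_add p (1 / a) ((d - 1) / E)]
  · have hω1 : ω ≤ 1 := by rw [hω, div_le_one hs0, hh, hs]; linarith [mul_pos (sub_pos.2 h1) hu0]
    have huE : u ≤ E := by rw [hE]; linarith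
    -- For `ℓ < 1` the last summand is negative; it is absorbed by `(d - 1) / E`, and `V ω` is
    -- absorbed by `p / a` alone.
    have haE : d * a ≤ ℓ * E := by linarith [mul_le_mul_of_nonneg_left huE hℓ.le]
    have hVu : V ≤ u := by
      have h2 : ℓ * E * V ≤ ℓ * E * u := by
        rw [hVq]
        have : (d - 1) * (a * u) ≤ ℓ * E * u := by
          linarith [mul_le_mul_of_nonneg_right haE hu0.le, mul_pos ha hu0]
        linarith [mul_le_of_le_one_left hk.le hω1]
      exact le_of_mul_le_mul_left h2 (by positivity)
    have hω2 : ω ≤ (ℓ + 2) / 3 := by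
      rw [hω, div_le_iff₀ hs0, hh, hs]
      linarith [mul_nonneg (sub_nonneg.2 h1.le) (sub_nonneg.2 hVu)]
    have h3 : 0 ≤ (d - 1) / E + (ℓ - 1) * V / (h * s) := by
      have : (1 - ℓ) * V / (h * s) ≤ (d - 1) / E := by
        rw [div_le_div_iff₀ (by positivity) hE0]
        have h4 : V * E * ℓ ≤ ω * ((d - 1) * (a * u)) := by linarith
        have h5 : ω * ((d - 1) * (a * u)) ≤ ω * ((d - 1) * (ℓ * (u * u))) := by
          gcongr ω * ((d - 1) * ?_)
          linarith [mul_le_mul_of_nonneg_right (by linarith : a ≤ ℓ * u) hu0.le]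
        have h6 : V * E ≤ ω * ((d - 1) * (u * u)) :=
          le_of_mul_le_mul_left (by linarith) hℓ
        have h7 : ω * ((d - 1) * (u * u)) ≤ (d - 1) * (h * s) := by
          rw [hωs, show (d - 1) * (ω * s * s) = ω * ((d - 1) * (s * s)) by ring]
          have : u ≤ s := by linarith
          gcongr
        linarith [mul_pos hℓ (mul_pos hV hE0)]
      have h8 : (ℓ - 1) * V / (h * s) = - ((1 - ℓ) * V / (h * s)) := by ring
      linarith
    have hmain : u * (ℓ + 1) * a + ω ^ 2 * ((d - 1) * (a * u)) / (ℓ * E) * a ≤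
        u * a * (ℓ + d) - ω * ((d - 1) * (a * u)) / (ℓ + 1) := by
      have h4 : a / (ℓ * E) ≤ 1 / 2 := by
        rw [div_le_div_iff₀ (by positivity) two_pos]
        linarith [mul_nonneg (sub_nonneg.2 hd) ha.le]
      have h5 : ω / (ℓ + 1) + ω ^ 2 * (1 / 2) ≤ 1 := by
        have : ω / (ℓ + 1) + ω ^ 2 * (1 / 2) ≤
            (ℓ + 2) / 3 / (ℓ + 1) + ((ℓ + 2) / 3) ^ 2 * (1 / 2) := by gcongr
        refine this.trans ?_
        rw [div_add' _ _ _ (by positivity), div_le_one (by positivity)]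
        linarith [mul_nonneg (sub_nonneg.2 h1.le) (by positivity : 0 ≤ ℓ ^ 2 + 6 * ℓ + 2)]
      have h6 : ω / (ℓ + 1) + ω ^ 2 * (a / (ℓ * E)) ≤ 1 :=
        le_trans (by gcongr) h5
      have h7 := mul_le_mul_of_nonneg_left h6
        (mul_pos hd1 (mul_pos ha hu0)).le
      have e1 : ω ^ 2 * ((d - 1) * (a * u)) / (ℓ * E) * a =
        (d - 1) * (a * u) * (ω ^ 2 * (a / (ℓ * E))) := by ring
      have e2 : ω * ((d - 1) * (a * u)) / (ℓ + 1) = (d - 1) * (a * u) * (ω / (ℓ + 1)) := by ring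
      rw [e1, e2]; linarith
    have hp2 : u * (ℓ + 1) + V * ω < p * (1 / a) := by
      rw [mul_one_div, lt_div_iff₀ ha]
      linarith [mul_lt_mul_of_pos_right hVω ha]
    have hp0 : 0 < p := by
      have : 0 < p * (1 / a) := lt_trans (by positivity) hp2
      exact pos_of_mul_pos_left this (by positivity)
    have h9 : p * (1 / a) ≤
        p * (1 / a + (d - 1) * a / q + (d - 1) / E + (ℓ - 1) * V / (h * s)) :=
      mul_le_mul_of_nonneg_left (by linarith) hp0.le
    linarith

/-- The quadratic `q(w)` whose roots are the `w`-coordinates of the triple points `Δ = Δ₁ = Δ₂ = 0`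
with `σ = 1 - w ≠ 0`; also `q(w) = w (r - w) - (1 - w) d (w - w_e)`. -/
def quadQ (d ℓ r w : ℝ) : ℝ := (d - 1) * w ^ 2 - (ℓ * (r - 1) + d - r) * w + ℓ * (r - 1)

/-- The quantity `e = d (w - w_e)`, written without the division hidden in `w_e`. -/
def excess (d ℓ r w : ℝ) : ℝ := d * w - ℓ * (r - 1)

/-- The quantity `H = 1 - w - w' - (σ + σ')` at `σ = 1 - w + V`, when `w'` and `σ'` are expressed
through the sonic quotient `T = q(w) / (σ² - (1 - w)²)`.

Here and below `V` and `T` are coordinates independent of `w`; along a trajectory they are tied by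
`q(w) = T V (2 (1 - w) + V)`. Treating `T` as a coordinate blows up the point `P₂`, where
`V = 0` and `q(w) = 0`. -/
def gap (d ℓ r w V T : ℝ) : ℝ :=
  1 - w + excess d ℓ r w - (1 - w + (1 - w + V) / ℓ) * T

/-- The velocity `w' = -d (w - w_e) + (1 - w) T`. -/
def wVel (d ℓ r w T : ℝ) : ℝ := -excess d ℓ r w + (1 - w) * T

/-- The derivative of `σ² - (1 - w)²` along the flow, where `σ' = σ (T / ℓ - 1)`. -/
def sonicRate (d ℓ r w V T : ℝ) : ℝ :=
  2 * (1 - w + V) * ((1 - w + V) * (T / ℓ - 1)) + 2 * (1 - w) * wVel d ℓ r w T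

/-- The derivative of the sonic quotient `T` along the flow, multiplied by `σ² - (1 - w)²`; unlike
that derivative it is a polynomial in `(w, V, T)`. -/
def quotRate (d ℓ r w V T : ℝ) : ℝ :=
  (2 * (d - 1) * w - (ℓ * (r - 1) + d - r)) * wVel d ℓ r w T - T * sonicRate d ℓ r w V T

/-- The derivative of `H` along the flow, multiplied by `σ² - (1 - w)² = V (2 (1 - w) + V)`. -/
def gapRate (d ℓ r w V T : ℝ) : ℝ :=
  V * (2 * (1 - w) + V) * ((d - 1) * wVel d ℓ r w T -
      (-wVel d ℓ r w T + (1 - w + V) * (T / ℓ - 1) / ℓ) * T) -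
    (1 - w + (1 - w + V) / ℓ) * quotRate d ℓ r w V T

/-- What the argument needs to know about the speed `r`: the number `W` in `(0, 1)` is the smaller
root of `q`, `κ = -q'(W) > 0`, and `0 < d (W - w_e) < ℓ (1 - W)`. The last inequality says that `P₂`
is a node and not a saddle; for `ℓ < d` it degenerates to an equality at `r = r*`. -/
structure Admissible (d ℓ r W κ : ℝ) : Prop where
  hd : 2 ≤ d
  hℓ : 0 < ℓ
  hr : 1 < r
  hκ : 0 < κ
  W_pos : 0 < W
  W_lt : W < 1
  quadQ_eq : ∀ w, quadQ d ℓ r w = (W - w) * (κ + (d - 1) * (W - w))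
  excess_pos : 0 < excess d ℓ r W
  excess_lt : excess d ℓ r W < ℓ * (1 - W)

namespace Admissible

variable {d ℓ r W κ : ℝ}

theorem κ_lt (h : Admissible d ℓ r W κ) : κ < (d - 1) * (1 - W) := by
  have h1 := h.quadQ_eq 1
  have h2 : quadQ d ℓ r 1 = r - 1 := by unfold quadQ; ring
  have := h.hr; have := h.W_lt
  by_contra hc
  nlinarith

theorem quadQ_pos (h : Admissible d ℓ r W κ) {w : ℝ} (hw : w < W) : 0 < quadQ d ℓ r w := by
  rw [h.quadQ_eq]
  have := h.hd; have := h.hκ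
  have : 0 ≤ (d - 1) * (W - w) := mul_nonneg (by linarith) (by linarith)
  exact mul_pos (by linarith) (by linarith)

theorem quadQ_deriv_eq (h : Admissible d ℓ r W κ) (w : ℝ) :
    2 * (d - 1) * w - (ℓ * (r - 1) + d - r) = -(κ + 2 * (d - 1) * (W - w)) := by
  have h0 := h.quadQ_eq w
  have h1 := h.quadQ_eq (w + 1)
  have h2 := h.quadQ_eq (w - 1)
  unfold quadQ at h0 h1 h2
  linear_combination (h1 - h2) / 2

/-- The flow crosses `H = 0` towards `H > 0`, at points inside the light cone with
`w_e ≤ w < W`. -/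
theorem gapRate_pos (h : Admissible d ℓ r W κ) {w V T : ℝ} (hw : w < W) (hV : 0 < V)
    (he : 0 ≤ excess d ℓ r w) (hq : quadQ d ℓ r w = T * (V * (2 * (1 - w) + V)))
    (hH : gap d ℓ r w V T = 0) : 0 < gapRate d ℓ r w V T := by
  have hd := h.hd
  have hℓ := h.hℓ
  have hW := h.W_lt
  have hq0 := h.quadQ_pos hw
  have hqW := h.quadQ_eq w
  have hκ := h.κ_lt
  have hq' := h.quadQ_deriv_eq w
  have hex := h.excess_lt
  obtain ⟨a, rfl⟩ : ∃ a, W = w + a := ⟨W - w, by ring⟩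
  obtain ⟨u, rfl⟩ : ∃ u, w = 1 - u := ⟨1 - w, by ring⟩
  have hexc : excess d ℓ r (1 - u + a) = excess d ℓ r (1 - u) + d * a := by unfold excess; ring
  rw [hexc] at hex
  unfold gapRate quotRate sonicRate wVel
  unfold gap at hH
  rw [hq']
  rw [add_sub_cancel_left] at hqW hq' ⊢
  rw [sub_sub_cancel] at hq hH ⊢
  generalize excess d ℓ r (1 - u) = e at *
  generalize quadQ d ℓ r (1 - u) = q at *
  have ha0 : 0 < a := by linarith
  have hau : a < u := by linarith
  have hu0 : 0 < u := by linarith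
  have hE0 : 0 < u + e := by linarith
  have hh0 : 0 < (ℓ + 1) * u + V := by positivity
  have hs0 : 0 < 2 * u + V := by positivity
  have hT : T = ℓ * (u + e) / ((ℓ + 1) * u + V) := by
    rw [eq_div_iff hh0.ne']
    field_simp at hH
    linarith
  have hqT : q = ℓ * (u + e) / ((ℓ + 1) * u + V) * (V * (2 * u + V)) := by rw [hq, hT]
  have key := barrier_ineq (d := d) (ℓ := ℓ) (a := a) (u := u) (V := V) (e := e) (q := q) hd hℓ ha0
    hau hV he (by nlinarith) rfl rfl rfl hq0
    (by rw [hqW]; nlinarith) (by rw [hqT]; field_simp)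
  -- The rate is `q / ℓ` times the difference of the two sides of `barrier_ineq`.
  have hκq : κ = q / a - (d - 1) * a := by rw [hqW]; field_simp; ring
  rw [← sub_pos] at key
  have := mul_pos (div_pos hq0 hℓ) key
  refine lt_of_lt_of_eq this ?_
  rw [hκq, hT, hqT]
  field_simp
  ring

/-- The same crossing property on the blow-up of `P₂`. There the rate factors as
`κ (1 - W) (ℓ (1 - W) - d (W - w_e)) / ℓ`, so that its sign is the node condition. -/
theorem gapRate_pos_end (h : Admissible d ℓ r W κ) {T : ℝ}
    (hH : gap d ℓ r W 0 T = 0) : 0 < gapRate d ℓ r W 0 T := by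
  have hd := h.hd
  have hℓ := h.hℓ
  have hW := h.W_lt
  have hq' := h.quadQ_deriv_eq W
  have hex := h.excess_lt
  have hex0 := h.excess_pos
  have hκ := h.hκ
  unfold gapRate quotRate sonicRate wVel
  unfold gap at hH
  rw [hq']
  obtain ⟨u, rfl⟩ : ∃ u, W = 1 - u := ⟨1 - W, by ring⟩
  rw [sub_sub_cancel] at hex hH ⊢
  generalize excess d ℓ r (1 - u) = e at *
  have hu0 : 0 < u := by linarith
  have hT : T = ℓ * (u + e) / ((ℓ + 1) * u) := by
    rw [eq_div_iff (by positivity)]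
    field_simp at hH
    linarith
  have : 0 < κ * (ℓ * u - e) * u / ℓ := by
    have : 0 < ℓ * u - e := by linarith
    positivity
  refine lt_of_lt_of_eq this ?_
  rw [hT]
  field_simp
  ring

end Admissible

/-! ### Admissibility of the speeds below the limiting speed -/

theorem excess_eq {d : ℝ} (hd : d ≠ 0) (ℓ r w : ℝ) : d * (w - wE d ℓ r) = excess d ℓ r w := by
  unfold excess wE
  field_simp

/-- The bounds on `d (W - w_e)` follow from the position of the root `W` alone: since `q(W) = 0`,
`(ℓ (1 - W) - d (W - w_e)) (W + ℓ (1 - W)) = ℓ² (1 - W)² - d W²`. -/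
theorem Admissible.of_root {d ℓ r W κ : ℝ} (hd : 2 ≤ d) (hℓ : 0 < ℓ) (hr : 1 < r) (hκ : 0 < κ)
    (hW : 0 < W) (hW1 : W < 1) (hfac : ∀ w, quadQ d ℓ r w = (W - w) * (κ + (d - 1) * (W - w)))
    (hm : √d * W < ℓ * (1 - W)) : Admissible d ℓ r W κ := by
  have h0 : quadQ d ℓ r W = 0 := by rw [hfac]; ring
  have hU : 0 < 1 - W := by linarith
  have hP : 0 < W + ℓ * (1 - W) := by positivity
  have e1 : excess d ℓ r W * (W + ℓ * (1 - W)) = W * (d * W + ℓ * (1 - W)) := by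
    unfold quadQ at h0
    unfold excess
    linear_combination (-ℓ) * h0
  have e2 : (ℓ * (1 - W) - excess d ℓ r W) * (W + ℓ * (1 - W)) =
      (ℓ * (1 - W) - √d * W) * (ℓ * (1 - W) + √d * W) := by
    have hs : √d * √d = d := Real.mul_self_sqrt (by linarith)
    linear_combination -e1 + W ^ 2 * hs
  refine ⟨hd, hℓ, hr, hκ, hW, hW1, hfac, ?_, ?_⟩
  · exact pos_of_mul_pos_left (lt_of_lt_of_eq (by positivity) e1.symm) hP.le
  · have : 0 < (ℓ * (1 - W) - excess d ℓ r W) * (W + ℓ * (1 - W)) := by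
      rw [e2]
      have := Real.sqrt_nonneg d
      exact mul_pos (by linarith) (by positivity)
    linarith [pos_of_mul_pos_left this hP.le]

theorem discJ_eq {d ℓ : ℝ} (hd : d ≠ 0) (hℓ : ℓ ≠ 0) (r : ℝ) :
    discJ d ℓ r = (ℓ * (r - 1) + d - r) ^ 2 - 4 * (d - 1) * (ℓ * (r - 1)) := by
  unfold discJ wE
  field_simp
  ring

theorem wP2_eq {d ℓ : ℝ} (hd : d ≠ 0) (hℓ : ℓ ≠ 0) (r : ℝ) :
    wP2 d ℓ r = (ℓ * (r - 1) + d - r - √(discJ d ℓ r)) / (2 * (d - 1)) := by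
  unfold wP2 wE
  congr 2
  field_simp
  ring

theorem quadQ_factor {d ℓ r : ℝ} (hd : 1 < d) (hℓ : ℓ ≠ 0) (hJ : 0 ≤ discJ d ℓ r) (w : ℝ) :
    quadQ d ℓ r w = (wP2 d ℓ r - w) * (√(discJ d ℓ r) + (d - 1) * (wP2 d ℓ r - w)) := by
  have hd1 : d - 1 ≠ 0 := by linarith
  have h1 := Real.sq_sqrt hJ
  have h2 := wP2_eq (by linarith : d ≠ 0) hℓ r
  rw [eq_div_iff (by positivity)] at h2
  rw [discJ_eq (by linarith) hℓ] at h1 h2 ⊢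
  generalize √((ℓ * (r - 1) + d - r) ^ 2 - 4 * (d - 1) * (ℓ * (r - 1))) = κ at *
  generalize wP2 d ℓ r = W at *
  have h3 : κ = ℓ * (r - 1) + d - r - W * (2 * (d - 1)) := by linarith
  unfold quadQ
  rw [h3] at h1 ⊢
  have h4 : (d - 1) * W ^ 2 - (ℓ * (r - 1) + d - r) * W + ℓ * (r - 1) = 0 := by
    have : 4 * (d - 1) * ((d - 1) * W ^ 2 - (ℓ * (r - 1) + d - r) * W + ℓ * (r - 1)) = 0 := by
      linear_combination h1
    exact (mul_eq_zero.1 this).resolve_left (by positivity)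
  linear_combination h4

theorem one_lt_rInf {d ℓ : ℝ} (hd : 1 < d) (hℓ : 0 < ℓ) : 1 < rInf d ℓ := by
  unfold rInf rStar rPlus
  split_ifs
  · have : 0 < √d := Real.sqrt_pos.2 (by linarith)
    rw [one_lt_div (by positivity)]
    have : √d < d := by
      rw [Real.sqrt_lt' (by linarith)]
      nlinarith
    linarith
  · have : 0 < (d - 1) / (1 + √ℓ) ^ 2 := div_pos (by linarith) (by positivity)
    linarith

/-- Below `r*` the point `v = ℓ r / (ℓ + d)`, where `d (v - w_e) = ℓ (1 - v)`, satisfies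
`q(v) < 0`, and therefore lies strictly between the two roots of `q`. -/
theorem admissible_of_lt_rStar {d ℓ r : ℝ} (hd : 2 ≤ d) (hℓ : 0 < ℓ) (hr : 1 < r)
    (hrs : r < rStar d ℓ) : Admissible d ℓ r (wP2 d ℓ r) √(discJ d ℓ r) := by
  have hs : √d * √d = d := Real.mul_self_sqrt (by linarith)
  have hs0 : 0 < √d := Real.sqrt_pos.2 (by linarith)
  obtain ⟨v, hv⟩ : ∃ v, v = ℓ * r / (ℓ + d) := ⟨_, rfl⟩
  have hv0 : 0 < v := by rw [hv]; positivity
  have hv' : v * (ℓ + d) = ℓ * r := by rw [hv]; field_simp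
  have hvs : v * (ℓ + √d) < ℓ := by
    unfold rStar at hrs
    rw [lt_div_iff₀ (by positivity)] at hrs
    have : v * (ℓ + √d) * (ℓ + d) < ℓ * (ℓ + d) := by
      calc v * (ℓ + √d) * (ℓ + d) = ℓ * (r * (ℓ + √d)) := by linear_combination (ℓ + √d) * hv'
        _ < ℓ * (ℓ + d) := by rw [add_comm ℓ d]; gcongr
    exact lt_of_mul_lt_mul_right this (by positivity)
  have hv1 : v < 1 := by
    by_contra hc
    nlinarith
  have hqv : quadQ d ℓ r v < 0 := by
    have : ℓ * quadQ d ℓ r v = (√d * v - ℓ * (1 - v)) * (√d * v + ℓ * (1 - v)) := by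
      unfold quadQ
      linear_combination -(ℓ - ℓ * v + v) * hv' - v ^ 2 * hs
    have h2 : 0 < √d * v + ℓ * (1 - v) := by
      have : 0 < 1 - v := by linarith
      positivity
    have h3 : ℓ * quadQ d ℓ r v < 0 := by
      rw [this]; exact mul_neg_of_neg_of_pos (by linarith) h2
    exact (pos_iff_neg_of_mul_neg h3).1 hℓ
  have hJ : 0 < discJ d ℓ r := by
    have : 4 * (d - 1) * quadQ d ℓ r v =
        (2 * (d - 1) * v - (ℓ * (r - 1) + d - r)) ^ 2 - discJ d ℓ r := by
      rw [discJ_eq (by linarith) hℓ.ne']; unfold quadQ; ring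
    nlinarith [sq_nonneg (2 * (d - 1) * v - (ℓ * (r - 1) + d - r))]
  have hκ : 0 < √(discJ d ℓ r) := Real.sqrt_pos.2 hJ
  have hfac := quadQ_factor (by linarith : 1 < d) hℓ.ne' hJ.le
  generalize √(discJ d ℓ r) = κ at *
  generalize wP2 d ℓ r = W at *
  have hWv : W < v := by
    by_contra hc
    push Not at hc
    rw [hfac] at hqv
    have : 0 ≤ (d - 1) * (W - v) := mul_nonneg (by linarith) (by linarith)
    nlinarith
  have hplus : 0 < κ + (d - 1) * (W - v) := by
    by_contra hc
    push Not at hc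
    rw [hfac] at hqv
    nlinarith
  have hW0 : 0 < W := by
    have h0 := hfac 0
    have h1 : quadQ d ℓ r 0 = ℓ * (r - 1) := by unfold quadQ; ring
    have h2 : 0 < ℓ * (r - 1) := mul_pos hℓ (by linarith)
    rw [h1, sub_zero] at h0
    have h3 : 0 < κ + (d - 1) * W := by nlinarith
    rw [h0] at h2
    exact pos_of_mul_pos_left h2 h3.le
  refine .of_root hd hℓ hr hκ hW0 (hWv.trans hv1) hfac ?_
  nlinarith

/-- Below `r₊` the discriminant `J` is positive, and the vertex of `q` lies to the left of
`√ℓ / (1 + √ℓ)`; for `d < ℓ` this is far enough for the node condition at `P₂`. -/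
theorem admissible_of_lt_rPlus {d ℓ r : ℝ} (hd : 2 ≤ d) (hdℓ : d < ℓ) (hr : 1 < r)
    (hrs : r < rPlus d ℓ) : Admissible d ℓ r (wP2 d ℓ r) √(discJ d ℓ r) := by
  have hℓ : 0 < ℓ := by linarith
  have ht : √ℓ * √ℓ = ℓ := Real.mul_self_sqrt hℓ.le
  have ht1 : 1 < √ℓ := by rw [Real.lt_sqrt zero_le_one]; linarith
  have hdt : √d < √ℓ := Real.sqrt_lt_sqrt (by linarith) hdℓ
  have hρ : (r - 1) * (1 + √ℓ) ^ 2 < d - 1 := by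
    unfold rPlus at hrs
    rw [← lt_div_iff₀ (by positivity)]
    linarith
  obtain ⟨B, hB⟩ : ∃ B, B = ℓ * (r - 1) + d - r := ⟨_, rfl⟩
  have hB0 : 0 < B := by rw [hB]; nlinarith
  have hJeq := discJ_eq (by linarith : d ≠ 0) hℓ.ne' r
  have hJ : 0 < discJ d ℓ r := by
    have : discJ d ℓ r = (d - 1 - (r - 1) * (1 + √ℓ) ^ 2) * (d - 1 - (r - 1) * (√ℓ - 1) ^ 2) := by
      have aux : ∀ t, t * t = ℓ → discJ d ℓ r =
          (d - 1 - (r - 1) * (1 + t) ^ 2) * (d - 1 - (r - 1) * (t - 1) ^ 2) := by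
        rintro t rfl; rw [hJeq]; ring
      exact aux _ ht
    rw [this]
    refine mul_pos (by linarith) ?_
    have : (r - 1) * (√ℓ - 1) ^ 2 ≤ (r - 1) * (1 + √ℓ) ^ 2 :=
      mul_le_mul_of_nonneg_left (by nlinarith) (by linarith)
    linarith
  have hκ : 0 < √(discJ d ℓ r) := Real.sqrt_pos.2 hJ
  have hκB : √(discJ d ℓ r) < B := by
    rw [Real.sqrt_lt' hB0, hJeq, hB]
    have : 0 < 4 * (d - 1) * (ℓ * (r - 1)) :=
      mul_pos (by linarith) (mul_pos hℓ (by linarith))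
    linarith
  have hfac := quadQ_factor (by linarith : 1 < d) hℓ.ne' hJ.le
  have hW := wP2_eq (by linarith : d ≠ 0) hℓ.ne' r
  rw [← hB, eq_div_iff (by linarith)] at hW
  generalize √(discJ d ℓ r) = κ at *
  generalize wP2 d ℓ r = W at *
  have hd1 : 0 < d - 1 := by linarith
  have hW0 : 0 < W := by
    by_contra hc
    nlinarith
  have hWt : W * (1 + √ℓ) < √ℓ := by
    have h1 : (1 + √ℓ) * B < 2 * (d - 1) * √ℓ := by
      have : (1 + √ℓ) * B = (√ℓ - 1) * ((r - 1) * (1 + √ℓ) ^ 2) + (1 + √ℓ) * (d - 1) := by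
        rw [hB]; nth_rewrite 2 [← ht]; ring
      rw [this]
      nlinarith [mul_lt_mul_of_pos_left hρ (by linarith : 0 < √ℓ - 1)]
    have h2 : 2 * (d - 1) * (W * (1 + √ℓ)) < 2 * (d - 1) * √ℓ := by
      refine lt_trans ?_ h1
      nlinarith
    exact lt_of_mul_lt_mul_left h2 (by linarith)
  have hW1 : W < 1 := by
    by_contra hc
    nlinarith
  refine .of_root hd hℓ hr hκ hW0 hW1 hfac ?_
  calc √d * W ≤ √ℓ * W := by gcongr
    _ < √ℓ * (√ℓ * (1 - W)) := by
      apply mul_lt_mul_of_pos_left _ (by linarith)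
      linarith
    _ = ℓ * (1 - W) := by rw [← mul_assoc, ht]

/-! ### Scalar differential inequalities -/

/-- A continuous function on `(-∞, b)` that is positive near `-∞` and has no first zero is
positive. -/
theorem pos_of_first_zero {f : ℝ → ℝ} {b : ℝ} (hf : ContinuousOn f (Iio b))
    (hbot : ∀ᶠ x in atBot, 0 < f x)
    (hzero : ∀ x < b, (∀ y < x, 0 < f y) → f x ≠ 0) : ∀ x < b, 0 < f x := by
  intro x₁ hx₁
  by_contra hneg
  push Not at hneg
  obtain ⟨m, hm⟩ := eventually_atBot.1 hbot
  have hmx : m < x₁ := by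
    by_contra hc
    exact absurd (hm x₁ (not_lt.1 hc)) (not_lt.2 hneg)
  let S := {y ∈ Icc m x₁ | f y ≤ 0}
  have hsub : Icc m x₁ ⊆ Iio b := fun y hy => lt_of_le_of_lt hy.2 hx₁
  have hScl : IsClosed S := (hf.mono hsub).preimage_isClosed_of_isClosed isClosed_Icc isClosed_Iic
  have hSb : BddBelow S := ⟨m, fun y hy => hy.1.1⟩
  have hmem : sInf S ∈ S := hScl.csInf_mem ⟨x₁, ⟨hmx.le, le_rfl⟩, hneg⟩ hSb
  have hbefore : ∀ y < sInf S, 0 < f y := by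
    intro y hy
    by_contra hc
    rcases le_total y m with h | h
    · exact hc (hm y h)
    · exact absurd (csInf_le hSb ⟨⟨h, hy.le.trans hmem.1.2⟩, not_lt.1 hc⟩) (not_le.2 hy)
  have hcont : ContinuousAt f (sInf S) :=
    hf.continuousAt (Iio_mem_nhds (hsub hmem.1))
  have hge : 0 ≤ f (sInf S) := by
    refine ge_of_tendsto (hcont.mono_left nhdsWithin_le_nhds : Tendsto f (𝓝[<] (sInf S)) _) ?_
    filter_upwards [self_mem_nhdsWithin] with y hy using (hbefore y hy).le
  exact hzero _ (hsub hmem.1) hbefore (le_antisymm hmem.2 hge)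

theorem deriv_nonpos_of_first_zero {f : ℝ → ℝ} {f' x : ℝ} (hf : HasDerivAt f f' x)
    (hpos : ∀ y < x, 0 < f y) (h0 : f x = 0) : f' ≤ 0 := by
  have h := (hasDerivAt_iff_tendsto_slope.1 hf).mono_left
    (nhdsWithin_mono x (show Iio x ⊆ {x}ᶜ from fun y hy => (mem_Iio.1 hy).ne))
  refine le_of_tendsto h ?_
  filter_upwards [self_mem_nhdsWithin] with y hy
  rw [slope_def_field, h0]
  have hy' : y < x := hy
  exact div_nonpos_of_nonneg_of_nonpos (by linarith [hpos y hy']) (by linarith)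

/-- If `f` is bounded below and decreases at rate at least `c / D` while `f ≥ τ`, where `D` vanishes
at most linearly at `x₂`, then `f ≤ τ` near `x₂`: the integral of `1 / D` diverges logarithmically. -/
theorem eventually_le_of_descent {f f' D : ℝ → ℝ} {x₁ x₂ τ c C L : ℝ} (hx : x₁ < x₂)
    (hf : ∀ x ∈ Ioo x₁ x₂, HasDerivAt f (f' x) x) (hL : ∀ x ∈ Ioo x₁ x₂, L ≤ f x)
    (hD : ∀ x ∈ Ioo x₁ x₂, 0 < D x) (hDC : ∀ x ∈ Ioo x₁ x₂, D x ≤ C * (x₂ - x)) (hc : 0 < c)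
    (hdesc : ∀ x ∈ Ioo x₁ x₂, τ ≤ f x → f' x * D x ≤ -c) :
    ∀ᶠ x in 𝓝[<] x₂, f x ≤ τ := by
  have hlow : ∃ x ∈ Ioo x₁ x₂, f x < τ := by
    by_contra hcon
    push Not at hcon
    obtain ⟨m, hm⟩ := exists_between hx
    have hC : 0 < C := by
      have h1 := (hD m hm).trans_le (hDC m hm)
      exact pos_of_mul_pos_left h1 (by linarith [hm.2])
    -- If `f ≥ τ` throughout, then `f` lies below a multiple of `log (x₂ - x)`, hence is unbounded.
    let g : ℝ → ℝ := fun x => f x - c / C * Real.log (x₂ - x)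
    have hg : ∀ x ∈ Ioo x₁ x₂, HasDerivAt g (f' x - c / C * (-1 / (x₂ - x))) x := by
      intro x hx
      have h1 : HasDerivAt (fun y => x₂ - y) (-1) x := by
        simpa using (hasDerivAt_id x).const_sub x₂
      exact (hf x hx).sub ((h1.log (by linarith [hx.2])).const_mul _)
    have hanti : AntitoneOn g (Ioo x₁ x₂) := by
      refine antitoneOn_of_deriv_nonpos (convex_Ioo _ _)
        (fun x hx => (hg x hx).continuousAt.continuousWithinAt) ?_ ?_
      · rw [interior_Ioo]
        exact fun x hx => (hg x hx).differentiableAt.differentiableWithinAt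
      · rw [interior_Ioo]
        intro x hx
        rw [(hg x hx).deriv]
        have hpos : 0 < x₂ - x := by linarith [hx.2]
        have h1 := hdesc x hx (hcon x hx)
        have h2 : f' x ≤ -c / D x := by rwa [le_div_iff₀ (hD x hx)]
        have h3 : c / (C * (x₂ - x)) ≤ c / D x :=
          div_le_div_of_nonneg_left hc.le (hD x hx) (hDC x hx)
        have h4 : c / C * (-1 / (x₂ - x)) = -(c / (C * (x₂ - x))) := by
          field_simp
        rw [h4]
        rw [neg_div] at h2
        linarith
    have hlim : Tendsto (fun x => c / C * Real.log (x₂ - x)) (𝓝[<] x₂) atBot := by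
      refine Tendsto.const_mul_atBot (by positivity) ?_
      refine Real.tendsto_log_nhdsGT_zero.comp ?_
      refine tendsto_nhdsWithin_iff.2 ⟨?_, ?_⟩
      · have : Tendsto (fun x => x₂ - x) (𝓝 x₂) (𝓝 (x₂ - x₂)) := by
          exact (continuous_const.sub continuous_id).tendsto x₂
        rw [sub_self] at this
        exact this.mono_left nhdsWithin_le_nhds
      · filter_upwards [self_mem_nhdsWithin] with x hx
        have : x < x₂ := hx
        exact mem_Ioi.2 (by linarith)
    have hev := (hlim.eventually_lt_atBot (L - g m)).and (Ioo_mem_nhdsLT hm.2)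
    obtain ⟨x, hx1, hx2⟩ := hev.exists
    have hxI : x ∈ Ioo x₁ x₂ := ⟨hm.1.trans hx2.1, hx2.2⟩
    have h1 := hanti hm hxI hx2.1.le
    have h2 := hL x hxI
    have h3 : g x = f x - c / C * Real.log (x₂ - x) := rfl
    linarith
  obtain ⟨x₀, hx₀, hfx₀⟩ := hlow
  filter_upwards [Ioo_mem_nhdsLT hx₀.2] with x hxx
  have hsub : ∀ y ∈ Icc x₀ x, y ∈ Ioo x₁ x₂ := fun y hy =>
    ⟨hx₀.1.trans_le hy.1, hy.2.trans_lt hxx.2⟩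
  refine image_le_of_deriv_right_lt_deriv_boundary (f := f) (f' := f') (B := fun _ => τ)
    (B' := fun _ => 0) (a := x₀) (b := x)
    (fun y hy => (hf y (hsub y hy)).continuousAt.continuousWithinAt)
    (fun y hy => (hf y (hsub y ⟨hy.1, hy.2.le⟩)).hasDerivWithinAt) hfx₀.le
    (fun y => hasDerivAt_const y τ) ?_ ⟨hxx.1.le, le_rfl⟩
  intro y hy hfy
  have hyI := hsub y ⟨hy.1, hy.2.le⟩
  have h1 := hdesc y hyI hfy.ge
  by_contra hc'
  have : 0 ≤ f' y * D y := mul_nonneg (not_lt.1 hc') (hD y hyI).le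
  linarith

/-- A bounded nonnegative solution of `D T' = -(A T² + B T - C)`, with `D` vanishing at most
linearly at `x₂`, converges to the positive root of the limiting quadratic, the only zero of
`A₀ t² + B₀ t - C₀` in `[0, ∞)`, which attracts. -/
theorem tendsto_pos_root {T T' D A B C : ℝ → ℝ} {A₀ B₀ C₀ τ M K x₁ x₂ : ℝ} (hx : x₁ < x₂)
    (hA₀ : 0 < A₀) (hC₀ : 0 < C₀) (hτ : 0 < τ) (hroot : A₀ * τ ^ 2 + B₀ * τ = C₀)
    (hT : ∀ x ∈ Ioo x₁ x₂, HasDerivAt T (T' x) x)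
    (hT' : ∀ x ∈ Ioo x₁ x₂, T' x * D x = -(A x * T x ^ 2 + B x * T x - C x))
    (hT0 : ∀ x ∈ Ioo x₁ x₂, 0 ≤ T x) (hTM : ∀ x ∈ Ioo x₁ x₂, T x ≤ M)
    (hD : ∀ x ∈ Ioo x₁ x₂, 0 < D x) (hDK : ∀ x ∈ Ioo x₁ x₂, D x ≤ K * (x₂ - x))
    (hA : Tendsto A (𝓝[<] x₂) (𝓝 A₀)) (hB : Tendsto B (𝓝[<] x₂) (𝓝 B₀))
    (hC : Tendsto C (𝓝[<] x₂) (𝓝 C₀)) : Tendsto T (𝓝[<] x₂) (𝓝 τ) := by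
  -- The limiting quadratic factors through `t - τ` with a cofactor at least `C₀ / τ` for `t ≥ 0`.
  have hB₀ : B₀ = C₀ / τ - A₀ * τ := by field_simp; linarith
  have hfac : ∀ t, A₀ * t ^ 2 + B₀ * t - C₀ = (t - τ) * (A₀ * t + C₀ / τ) := by
    intro t; rw [hB₀]; field_simp; ring
  have herr : Tendsto (fun x => |A x - A₀| * M ^ 2 + |B x - B₀| * M + |C x - C₀|)
      (𝓝[<] x₂) (𝓝 0) := by
    have h1 := ((hA.sub_const A₀).abs.mul_const (M ^ 2)).add
      (((hB.sub_const B₀).abs.mul_const M).add (hC.sub_const C₀).abs)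
    simpa [add_assoc] using h1
  have hbound : ∀ x ∈ Ioo x₁ x₂, |(A x * T x ^ 2 + B x * T x - C x) -
      (A₀ * T x ^ 2 + B₀ * T x - C₀)| ≤ |A x - A₀| * M ^ 2 + |B x - B₀| * M + |C x - C₀| := by
    intro x hx
    have h0 := hT0 x hx
    have h1 := hTM x hx
    calc _ = |(A x - A₀) * T x ^ 2 + (B x - B₀) * T x - (C x - C₀)| := by congr 1; ring
      _ ≤ |(A x - A₀) * T x ^ 2| + |(B x - B₀) * T x| + |C x - C₀| :=
          (abs_sub _ _).trans (add_le_add_left (abs_add_le _ _) _)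
      _ = |A x - A₀| * T x ^ 2 + |B x - B₀| * T x + |C x - C₀| := by
          rw [abs_mul, abs_mul, abs_of_nonneg h0, abs_of_nonneg (sq_nonneg (T x))]
      _ ≤ _ := by gcongr
  have hκ : 0 < C₀ / τ := by positivity
  have hclose : ∀ c > 0, ∃ x₃ ∈ Ico x₁ x₂, ∀ x ∈ Ioo x₃ x₂,
      |(A x * T x ^ 2 + B x * T x - C x) - (T x - τ) * (A₀ * T x + C₀ / τ)| < c := by
    intro c hc
    obtain ⟨y, hy, hysub⟩ := (mem_nhdsLT_iff_exists_Ioo_subset' hx).1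
      (herr.eventually_lt_const hc)
    refine ⟨max x₁ y, ⟨le_max_left _ _, max_lt hx hy⟩, fun x hxI => ?_⟩
    rw [← hfac]
    exact (hbound x ⟨(le_max_left _ _).trans_lt hxI.1, hxI.2⟩).trans_lt
      (hysub ⟨(le_max_right _ _).trans_lt hxI.1, hxI.2⟩)
  refine tendsto_order.2 ⟨fun b hb => ?_, fun b hb => ?_⟩
  · obtain ⟨τ', hτ', hτ''⟩ := exists_between hb
    have hc : 0 < (τ - τ') * (C₀ / τ) / 2 := by
      have : 0 < τ - τ' := by linarith
      positivity
    obtain ⟨x₃, hx₃, hcl⟩ := hclose _ hc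
    have hsub : ∀ x ∈ Ioo x₃ x₂, x ∈ Ioo x₁ x₂ := fun x hx => ⟨hx₃.1.trans_lt hx.1, hx.2⟩
    have := eventually_le_of_descent (f := fun x => -T x) (f' := fun x => -T' x) (τ := -τ')
      (L := -M) hx₃.2 (fun x hx => (hT x (hsub x hx)).neg)
      (fun x hx => neg_le_neg (hTM x (hsub x hx))) (fun x hx => hD x (hsub x hx))
      (fun x hx => hDK x (hsub x hx)) hc (fun x hx hTx => by
        have h1 := (abs_lt.1 (hcl x hx)).2
        have h2 := hT' x (hsub x hx)
        have h0 := hT0 x (hsub x hx)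
        have h3 : (τ - τ') * (C₀ / τ) ≤ (τ - T x) * (A₀ * T x + C₀ / τ) :=
          mul_le_mul (by linarith) (by nlinarith) hκ.le (by linarith)
        linarith)
    filter_upwards [this] with x hx
    linarith
  · obtain ⟨τ', hτ', hτ''⟩ := exists_between hb
    have hc : 0 < (τ' - τ) * (C₀ / τ) / 2 := by
      have : 0 < τ' - τ := by linarith
      positivity
    obtain ⟨x₃, hx₃, hcl⟩ := hclose _ hc
    have hsub : ∀ x ∈ Ioo x₃ x₂, x ∈ Ioo x₁ x₂ := fun x hx => ⟨hx₃.1.trans_lt hx.1, hx.2⟩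
    have := eventually_le_of_descent (f := T) (f' := T') (τ := τ')
      (L := 0) hx₃.2 (fun x hx => (hT x (hsub x hx)))
      (fun x hx => hT0 x (hsub x hx)) (fun x hx => hD x (hsub x hx))
      (fun x hx => hDK x (hsub x hx)) hc (fun x hx hTx => by
        have h1 := (abs_lt.1 (hcl x hx)).1
        have h2 := hT' x (hsub x hx)
        have h0 := hT0 x (hsub x hx)
        have h3 : (τ' - τ) * (C₀ / τ) ≤ (T x - τ) * (A₀ * T x + C₀ / τ) :=
          mul_le_mul (by linarith) (by nlinarith) hκ.le (by linarith)
        linarith)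
    filter_upwards [this] with x hx
    linarith

theorem exists_pos_root {A B C : ℝ} (hA : 0 < A) (hC : 0 < C) :
    ∃ τ, 0 < τ ∧ A * τ ^ 2 + B * τ = C := by
  have h0 : 0 ≤ B ^ 2 + 4 * A * C := by positivity
  have hlt : |B| < √(B ^ 2 + 4 * A * C) := by
    rw [← Real.sqrt_sq_eq_abs]
    exact Real.sqrt_lt_sqrt (sq_nonneg B) (by nlinarith [mul_pos hA hC])
  have hs := Real.sq_sqrt h0
  generalize √(B ^ 2 + 4 * A * C) = s at hs hlt
  refine ⟨(-B + s) / (2 * A), ?_, ?_⟩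
  · exact div_pos (by linarith [le_abs_self B]) (by positivity)
  · field_simp
    linear_combination hs

/-! ### A level of the gap that the flow crosses upwards -/

namespace Admissible

variable {d ℓ r W κ : ℝ}

theorem eq_of_quadQ_eq_zero (h : Admissible d ℓ r W κ) {w : ℝ} (hw : w ≤ W)
    (hq : quadQ d ℓ r w = 0) : w = W := by
  rcases hw.lt_or_eq with h1 | h1
  · exact absurd hq (h.quadQ_pos h1).ne'
  · exact h1

theorem pos_of_excess_nonneg (h : Admissible d ℓ r W κ) {w : ℝ} (he : 0 ≤ excess d ℓ r w) :
    0 < w := by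
  have := h.hd; have := mul_pos h.hℓ (sub_pos.2 h.hr)
  unfold excess at he
  by_contra hc
  nlinarith

theorem excess_le (h : Admissible d ℓ r W κ) {w : ℝ} (hw : w ≤ W) :
    excess d ℓ r w ≤ excess d ℓ r W := by
  have := h.hd
  unfold excess
  nlinarith

/-- A value of `V = σ + w - 1` beyond which `H` is bounded below, see `lt_gap_of_far`. -/
def farBound (d ℓ W κ : ℝ) : ℝ := 2 * (1 + 1 / ℓ) * (W * (κ + (d - 1) * W)) / (1 - W)

theorem farBound_pos (h : Admissible d ℓ r W κ) : 0 < farBound d ℓ W κ := by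
  have := h.hd; have := h.hℓ; have := h.W_pos; have := h.hκ
  have h1 : 0 < 1 - W := by linarith [h.W_lt]
  have h2 : 0 < d - 1 := by linarith
  unfold farBound
  positivity

theorem lt_gap_of_far (h : Admissible d ℓ r W κ) {w V T : ℝ} (hw : w ≤ W)
    (he : 0 ≤ excess d ℓ r w) (hT : 0 ≤ T) (hq : quadQ d ℓ r w = T * (V * (2 * (1 - w) + V)))
    (hV : farBound d ℓ W κ < V) : (1 - W) / 2 < gap d ℓ r w V T := by
  have hV0 : 0 < V := h.farBound_pos.trans hV
  have hd := h.hd; have hℓ := h.hℓ; have hκ := h.hκ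
  have hw0 := h.pos_of_excess_nonneg he
  have hU : 0 < 1 - W := by linarith [h.W_lt]
  have hqb : quadQ d ℓ r w ≤ W * (κ + (d - 1) * W) := by
    rw [h.quadQ_eq]
    have h1 : (d - 1) * (W - w) ≤ (d - 1) * W :=
      mul_le_mul_of_nonneg_left (by linarith) (by linarith)
    have h2 : 0 ≤ (d - 1) * (W - w) := mul_nonneg (by linarith) (by linarith)
    exact mul_le_mul (by linarith) (by linarith) (by linarith) h.W_pos.le
  unfold farBound at hV
  rw [div_lt_iff₀ hU] at hV
  have h3 : (1 + 1 / ℓ) * (T * (2 * (1 - w) + V)) < (1 - W) / 2 := by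
    have : (1 + 1 / ℓ) * (T * (2 * (1 - w) + V)) * V < (1 - W) / 2 * V := by
      calc (1 + 1 / ℓ) * (T * (2 * (1 - w) + V)) * V = (1 + 1 / ℓ) * quadQ d ℓ r w := by
            rw [hq]; ring
        _ ≤ (1 + 1 / ℓ) * (W * (κ + (d - 1) * W)) := by gcongr
        _ < _ := by linarith
    exact lt_of_mul_lt_mul_right this hV0.le
  have h4 : (1 - w + (1 - w + V) / ℓ) * T ≤ (1 + 1 / ℓ) * (T * (2 * (1 - w) + V)) := by
    have : (1 + 1 / ℓ) * (T * (2 * (1 - w) + V)) - (1 - w + (1 - w + V) / ℓ) * T =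
        T * (1 - w + V) + T * (1 - w) / ℓ := by ring
    have h5 : 0 ≤ T * (1 - w + V) + T * (1 - w) / ℓ := by
      have : 0 ≤ 1 - w := by linarith
      positivity
    linarith
  unfold gap
  linarith

theorem quot_le (h : Admissible d ℓ r W κ) {w V T : ℝ} (hw : w ≤ W) (hV : 0 ≤ V)
    (he : 0 ≤ excess d ℓ r w) (hT : 0 ≤ T) (hH : 0 ≤ gap d ℓ r w V T) :
    T ≤ (1 + excess d ℓ r W) / (1 - W) := by
  have hℓ := h.hℓ
  have hw0 := h.pos_of_excess_nonneg he
  have hU : 0 < 1 - W := by linarith [h.W_lt]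
  have hu : 0 < 1 - w := by linarith
  rw [le_div_iff₀ hU]
  unfold gap at hH
  have h1 : 0 ≤ (1 - w + V) / ℓ * T := by positivity
  have h2 := h.excess_le hw
  nlinarith

/-- The crossing property persists on a level `H = c` with `c > 0` depending on the parameters
only. The points with `H ≥ 0` where the rate of `H` is not positive form a compact set in the
`(w, V, T)`-space once `V` is bounded, and `H` has no zero there. -/
theorem exists_gap_level (h : Admissible d ℓ r W κ) :
    ∃ c, 0 < c ∧ c ≤ (1 - W) / 2 ∧ ∀ w V T, w ≤ W → 0 ≤ V → 0 ≤ excess d ℓ r w → 0 ≤ T →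
      quadQ d ℓ r w = T * (V * (2 * (1 - w) + V)) → gap d ℓ r w V T = c →
      0 < gapRate d ℓ r w V T := by
  have hU : 0 < 1 - W := by linarith [h.W_lt]
  let box : Set (ℝ × ℝ × ℝ) := Icc 0 W ×ˢ Icc 0 (farBound d ℓ W κ) ×ˢ
    Icc 0 ((1 + excess d ℓ r W) / (1 - W))
  let S : Set (ℝ × ℝ × ℝ) := box ∩ {p | 0 ≤ excess d ℓ r p.1 ∧
    quadQ d ℓ r p.1 = p.2.2 * (p.2.1 * (2 * (1 - p.1) + p.2.1)) ∧
    0 ≤ gap d ℓ r p.1 p.2.1 p.2.2 ∧ gapRate d ℓ r p.1 p.2.1 p.2.2 ≤ 0}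
  have hgap : Continuous fun p : ℝ × ℝ × ℝ => gap d ℓ r p.1 p.2.1 p.2.2 := by
    unfold gap excess; fun_prop
  have hrate : Continuous fun p : ℝ × ℝ × ℝ => gapRate d ℓ r p.1 p.2.1 p.2.2 := by
    unfold gapRate quotRate sonicRate wVel excess; fun_prop
  have hex : Continuous fun p : ℝ × ℝ × ℝ => excess d ℓ r p.1 := by unfold excess; fun_prop
  have hqc : Continuous fun p : ℝ × ℝ × ℝ => quadQ d ℓ r p.1 := by unfold quadQ; fun_prop
  have hS : IsCompact S := by
    refine (isCompact_Icc.prod (isCompact_Icc.prod isCompact_Icc)).inter_right ?_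
    refine (isClosed_le continuous_const hex).inter ((isClosed_eq hqc (by fun_prop)).inter
      ((isClosed_le continuous_const hgap).inter (isClosed_le hrate continuous_const)))
  have hpos : ∀ p ∈ S, 0 < gap d ℓ r p.1 p.2.1 p.2.2 := by
    rintro ⟨w, V, T⟩ ⟨⟨hw, hV, hT⟩, he, hq, hg, hr⟩
    simp only at hw hV hT he hq hg hr ⊢
    refine lt_of_le_of_ne hg fun h0 => ?_
    rcases hV.1.eq_or_lt with rfl | hV0
    · obtain rfl := h.eq_of_quadQ_eq_zero hw.2 (by rw [hq]; ring)
      exact absurd (h.gapRate_pos_end h0.symm) (not_lt.2 hr)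
    · rcases hw.2.eq_or_lt with rfl | hw'
      · have hq0 : quadQ d ℓ r w = 0 := by rw [h.quadQ_eq]; ring
        have hT0 : T = 0 := by
          rw [hq0] at hq
          exact (mul_eq_zero.1 hq.symm).resolve_right (by positivity)
        rw [hT0] at h0
        unfold gap at h0
        linarith
      · exact absurd (h.gapRate_pos hw' hV0 he hq h0.symm) (not_lt.2 hr)
  obtain ⟨c₀, hc₀, hc₀S⟩ : ∃ c₀, 0 < c₀ ∧ ∀ p ∈ S, c₀ ≤ gap d ℓ r p.1 p.2.1 p.2.2 := by
    rcases S.eq_empty_or_nonempty with hE | hne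
    · exact ⟨1, one_pos, by simp [hE]⟩
    · obtain ⟨p, hp, hmin⟩ := hS.exists_isMinOn hne hgap.continuousOn
      exact ⟨_, hpos p hp, fun p' hp' => hmin hp'⟩
  -- Half of `1 - W` keeps the level below the value of `H` far out.
  refine ⟨min c₀ (1 - W) / 2, by positivity, ?_, ?_⟩
  · linarith [min_le_right c₀ (1 - W)]
  · intro w V T hw hV he hT hq hg
    by_contra hcon
    have hmin0 : 0 < min c₀ (1 - W) := lt_min hc₀ hU
    have hg0 : 0 ≤ gap d ℓ r w V T := by rw [hg]; positivity
    have hVb : V ≤ farBound d ℓ W κ := by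
      by_contra hc
      have := h.lt_gap_of_far hw he hT hq (not_le.1 hc)
      linarith [min_le_right c₀ (1 - W)]
    have := hc₀S (w, V, T) ⟨⟨⟨(h.pos_of_excess_nonneg he).le, hw⟩, ⟨hV, hVb⟩,
      ⟨hT, h.quot_le hw hV he hT hg0⟩⟩, he, hq, hg0, not_lt.1 hcon⟩
    simp only at this
    linarith [min_le_left c₀ (1 - W)]

end Admissible

/-! ### Trajectories from `P₆` to `P₂` -/

/-- The distance `V = σ + w - 1` into the light cone along a trajectory. -/
def depth (σ w : ℝ → ℝ) (x : ℝ) : ℝ := σ x + w x - 1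

/-- The function `-Δ = σ² - (1 - w)²` along a trajectory, factored as `V (2 (1 - w) + V)`. -/
def sonicGap (σ w : ℝ → ℝ) (x : ℝ) : ℝ := depth σ w x * (2 * (1 - w x) + depth σ w x)

/-- The sonic quotient `T = q(w) / (σ² - (1 - w)²)` along a trajectory. -/
def sonicQuot (d ℓ r : ℝ) (σ w : ℝ → ℝ) (x : ℝ) : ℝ := quadQ d ℓ r (w x) / sonicGap σ w x

namespace IsP6P2Trajectory

variable {d ℓ r κ x₂ : ℝ} {σ w : ℝ → ℝ}

theorem sonicGap_mul_deriv_w (h : IsP6P2Trajectory d ℓ r σ w x₂) (hd : d ≠ 0) {x : ℝ}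
    (hx : x < x₂) : sonicGap σ w x * deriv w x =
      -excess d ℓ r (w x) * sonicGap σ w x + (1 - w x) * quadQ d ℓ r (w x) := by
  have h1 := h.ode_w x hx
  have h2 := excess_eq hd ℓ r (w x)
  unfold Delta Delta1 at h1
  rw [h2] at h1
  unfold sonicGap depth
  have h3 : quadQ d ℓ r (w x) = w x * (r - w x) - (1 - w x) * excess d ℓ r (w x) := by
    unfold quadQ excess; ring
  rw [h3]
  linear_combination -h1

theorem sonicGap_mul_deriv_σ (h : IsP6P2Trajectory d ℓ r σ w x₂) (hℓ : ℓ ≠ 0) {x : ℝ}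
    (hx : x < x₂) : sonicGap σ w x * deriv σ x = σ x * (quadQ d ℓ r (w x) / ℓ - sonicGap σ w x) := by
  have h1 := h.ode_σ x hx
  have h2 : Delta2 d ℓ r (σ x) (w x) = σ x * (quadQ d ℓ r (w x) / ℓ - sonicGap σ w x) := by
    unfold Delta2 quadQ sonicGap depth
    field_simp
    ring
  rw [h2] at h1
  unfold Delta at h1
  unfold sonicGap depth at *
  linear_combination -h1

theorem tendsto_depth (h : IsP6P2Trajectory d ℓ r σ w x₂) : Tendsto (depth σ w) atBot atTop := by
  unfold depth
  simp only [add_sub_assoc]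
  exact h.tendsto_σ.atTop_add (h.tendsto_w.sub_const 1)

theorem tendsto_w_end (h : IsP6P2Trajectory d ℓ r σ w x₂) :
    Tendsto w (𝓝[<] x₂) (𝓝 (wP2 d ℓ r)) := by
  have := h.continuousWithinAt_w.mono_left (nhdsWithin_mono x₂ Iio_subset_Iic_self)
  rwa [h.w_end] at this

theorem tendsto_σ_end (h : IsP6P2Trajectory d ℓ r σ w x₂) :
    Tendsto σ (𝓝[<] x₂) (𝓝 (1 - wP2 d ℓ r)) := by
  have := h.continuousWithinAt_σ.mono_left (nhdsWithin_mono x₂ Iio_subset_Iic_self)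
  rwa [h.σ_end] at this

/-- A trajectory stays inside the light cone and to the left of `w = W`. A first contact with the
sonic line would be a triple point with `w ≤ W`, hence `P₂` itself; and on `w = W` inside the cone
the field points to the left. -/
theorem depth_pos_and_w_lt (h : IsP6P2Trajectory d ℓ r σ w x₂)
    (hA : Admissible d ℓ r (wP2 d ℓ r) κ) :
    ∀ x < x₂, 0 < depth σ w x ∧ w x < wP2 d ℓ r := by
  have hd0 : d ≠ 0 := by linarith [hA.hd]
  have hwE : wE d ℓ r < wP2 d ℓ r := by
    have h1 := hA.excess_pos
    rw [← excess_eq hd0] at h1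
    linarith [pos_of_mul_pos_right h1 (by linarith [hA.hd])]
  have hcw : ∀ x < x₂, ContinuousAt w x := fun x hx => (h.differentiableAt_w x hx).continuousAt
  have hcσ : ∀ x < x₂, ContinuousAt σ x := fun x hx => (h.differentiableAt_σ x hx).continuousAt
  suffices ∀ x < x₂, 0 < min (depth σ w x) (wP2 d ℓ r - w x) from fun x hx => by
    have := lt_min_iff.1 (this x hx)
    exact ⟨this.1, by linarith [this.2]⟩
  refine pos_of_first_zero ?_ ?_ ?_
  · intro x hx
    have h1 := hcw x hx
    have h2 := hcσ x hx
    have h3 : ContinuousAt (depth σ w) x := (h2.add h1).sub continuousAt_const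
    have h4 : ContinuousAt (fun y => min (depth σ w y) (wP2 d ℓ r - w y)) x :=
      h3.min (continuousAt_const.sub h1)
    exact h4.continuousWithinAt
  · filter_upwards [h.tendsto_depth.eventually_gt_atTop 0, h.tendsto_w.eventually_lt_const hwE]
      with x h1 h2
    exact lt_min h1 (by linarith)
  · intro x hx hpos h0
    have hW1 := hA.W_lt
    have hboth : 0 ≤ depth σ w x ∧ 0 ≤ wP2 d ℓ r - w x := le_min_iff.1 h0.ge
    have hwW : w x ≤ wP2 d ℓ r := by linarith [hboth.2]
    rcases hboth.1.eq_or_lt with hV | hV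
    · have h1 := h.sonicGap_mul_deriv_w hd0 hx
      unfold sonicGap at h1
      rw [← hV] at h1
      have h2 : quadQ d ℓ r (w x) = 0 := by
        have : (1 - w x) * quadQ d ℓ r (w x) = 0 := by linarith
        exact (mul_eq_zero.1 this).resolve_left (by linarith)
      have h3 := hA.eq_of_quadQ_eq_zero hwW h2
      refine h.first_hit x hx ⟨?_, h3⟩
      unfold depth at hV
      unfold sigmaP2
      linarith
    · have hw0 : wP2 d ℓ r - w x = 0 := by
        rcases min_choice (depth σ w x) (wP2 d ℓ r - w x) with h1 | h1
        · rw [h1] at h0; exact absurd h0 hV.ne'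
        · rwa [h1] at h0
      have hder : HasDerivAt (fun y => wP2 d ℓ r - w y) (-deriv w x) x :=
        (h.differentiableAt_w x hx).hasDerivAt.const_sub _
      have h1 := deriv_nonpos_of_first_zero hder (fun y hy => (lt_min_iff.1 (hpos y hy)).2) hw0
      have h2 := h.sonicGap_mul_deriv_w hd0 hx
      have hwx : w x = wP2 d ℓ r := by linarith
      have hq : quadQ d ℓ r (w x) = 0 := by rw [hA.quadQ_eq, hwx]; ring
      have hD : 0 < sonicGap σ w x := by
        unfold sonicGap
        have : 0 < 1 - w x := by linarith
        positivity
      rw [hq, hwx] at h2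
      have h3 := mul_pos hA.excess_pos hD
      nlinarith

section

variable (h : IsP6P2Trajectory d ℓ r σ w x₂) (hA : Admissible d ℓ r (wP2 d ℓ r) κ)
include h hA

theorem sonicGap_pos {x : ℝ} (hx : x < x₂) : 0 < sonicGap σ w x := by
  obtain ⟨h1, h2⟩ := h.depth_pos_and_w_lt hA x hx
  have : 0 < 1 - w x := by linarith [hA.W_lt]
  unfold sonicGap
  positivity

theorem quadQ_eq_sonicQuot_mul {x : ℝ} (hx : x < x₂) : quadQ d ℓ r (w x) =
    sonicQuot d ℓ r σ w x * (depth σ w x * (2 * (1 - w x) + depth σ w x)) := by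
  have := h.sonicGap_pos hA hx
  unfold sonicQuot
  rw [← sonicGap, div_mul_cancel₀ _ this.ne']

theorem sonicQuot_pos {x : ℝ} (hx : x < x₂) : 0 < sonicQuot d ℓ r σ w x :=
  div_pos (hA.quadQ_pos (h.depth_pos_and_w_lt hA x hx).2) (h.sonicGap_pos hA hx)

theorem hasDerivAt_w {x : ℝ} (hx : x < x₂) :
    HasDerivAt w (wVel d ℓ r (w x) (sonicQuot d ℓ r σ w x)) x := by
  refine (h.differentiableAt_w x hx).hasDerivAt.congr_deriv ?_
  have hD := h.sonicGap_pos hA hx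
  have h1 := h.sonicGap_mul_deriv_w (by linarith [hA.hd]) hx
  unfold wVel sonicQuot
  field_simp
  linarith

theorem hasDerivAt_σ {x : ℝ} (hx : x < x₂) :
    HasDerivAt σ (σ x * (sonicQuot d ℓ r σ w x / ℓ - 1)) x := by
  refine (h.differentiableAt_σ x hx).hasDerivAt.congr_deriv ?_
  have hD := h.sonicGap_pos hA hx
  have hℓ := hA.hℓ
  have h1 := h.sonicGap_mul_deriv_σ hA.hℓ.ne' hx
  unfold sonicQuot
  field_simp at h1 ⊢
  linarith

/-- `w ≥ w_e` along a trajectory: `(w - w_e) e^{d x}` is nondecreasing and tends to `0` at `-∞`. -/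
theorem excess_nonneg {x : ℝ} (hx : x < x₂) : 0 ≤ excess d ℓ r (w x) := by
  have hd := hA.hd
  have hd0 : d ≠ 0 := by linarith
  let g : ℝ → ℝ := fun y => excess d ℓ r (w y) * Real.exp (d * y)
  have hg : ∀ y < x₂, HasDerivAt g
      (d * (1 - w y) * sonicQuot d ℓ r σ w y * Real.exp (d * y)) y := by
    intro y hy
    have h1 : HasDerivAt (fun y => excess d ℓ r (w y))
        (d * wVel d ℓ r (w y) (sonicQuot d ℓ r σ w y)) y :=
      ((h.hasDerivAt_w hA hy).const_mul d).sub_const _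
    have h2 : HasDerivAt (fun y => Real.exp (d * y)) (Real.exp (d * y) * (d * 1)) y :=
      ((hasDerivAt_id y).const_mul d).exp
    refine (h1.mul h2).congr_deriv ?_
    unfold wVel
    ring
  have hmono : MonotoneOn g (Iic x) := by
    refine monotoneOn_of_deriv_nonneg (convex_Iic x)
      (fun y hy => (hg y (lt_of_le_of_lt hy hx)).continuousAt.continuousWithinAt) ?_ ?_
    · rw [interior_Iic]
      exact fun y hy => (hg y (lt_trans hy hx)).differentiableAt.differentiableWithinAt
    · rw [interior_Iic]
      intro y hy
      have hy' : y < x₂ := lt_trans hy hx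
      rw [(hg y hy').deriv]
      have h1 := h.sonicQuot_pos hA hy'
      have h2 : 0 < 1 - w y := by linarith [hA.W_lt, (h.depth_pos_and_w_lt hA y hy').2]
      have h3 : 0 < d := by linarith
      positivity
  have hlim : Tendsto g atBot (𝓝 0) := by
    have h1 : Tendsto (fun y => excess d ℓ r (w y)) atBot (𝓝 (excess d ℓ r (wE d ℓ r))) := by
      unfold excess
      exact (h.tendsto_w.const_mul d).sub_const _
    have h2 : Tendsto (fun y => Real.exp (d * y)) atBot (𝓝 0) :=
      Real.tendsto_exp_atBot.comp (tendsto_id.const_mul_atBot (by linarith))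
    simpa using h1.mul h2
  have h0 : 0 ≤ g x := by
    refine le_of_tendsto hlim ?_
    filter_upwards [eventually_le_atBot x] with y hy
    exact hmono hy (mem_Iic.2 le_rfl) hy
  exact nonneg_of_mul_nonneg_left h0 (Real.exp_pos _)

theorem hasDerivAt_depth {x : ℝ} (hx : x < x₂) : HasDerivAt (depth σ w)
    (σ x * (sonicQuot d ℓ r σ w x / ℓ - 1) + wVel d ℓ r (w x) (sonicQuot d ℓ r σ w x)) x :=
  ((h.hasDerivAt_σ hA hx).add (h.hasDerivAt_w hA hx)).sub_const 1

theorem hasDerivAt_sonicGap {x : ℝ} (hx : x < x₂) : HasDerivAt (sonicGap σ w)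
    (sonicRate d ℓ r (w x) (depth σ w x) (sonicQuot d ℓ r σ w x)) x := by
  have h1 := h.hasDerivAt_depth hA hx
  have h2 := (((h.hasDerivAt_w hA hx).const_sub 1).const_mul 2).add h1
  refine (h1.mul h2).congr_deriv ?_
  simp only [Pi.add_apply]
  unfold sonicRate
  have : σ x = 1 - w x + depth σ w x := by unfold depth; ring
  rw [this]
  ring

theorem hasDerivAt_sonicQuot {x : ℝ} (hx : x < x₂) : HasDerivAt (sonicQuot d ℓ r σ w)
    (quotRate d ℓ r (w x) (depth σ w x) (sonicQuot d ℓ r σ w x) / sonicGap σ w x) x := by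
  have hD := h.sonicGap_pos hA hx
  have hw := h.hasDerivAt_w hA hx
  have hq : HasDerivAt (fun y => quadQ d ℓ r (w y))
      ((2 * (d - 1) * w x - (ℓ * (r - 1) + d - r)) *
        wVel d ℓ r (w x) (sonicQuot d ℓ r σ w x)) x := by
    unfold quadQ
    refine ((((hw.pow 2).const_mul (d - 1)).sub (hw.const_mul (ℓ * (r - 1) + d - r))).add_const
      (ℓ * (r - 1))).congr_deriv ?_
    push_cast
    ring
  refine (hq.div (h.hasDerivAt_sonicGap hA hx) hD.ne').congr_deriv ?_
  have h1 : quadQ d ℓ r (w x) = sonicQuot d ℓ r σ w x * sonicGap σ w x :=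
    h.quadQ_eq_sonicQuot_mul hA hx
  rw [h1]
  unfold quotRate
  field_simp

theorem hasDerivAt_gap {x : ℝ} (hx : x < x₂) :
    HasDerivAt (fun y => gap d ℓ r (w y) (depth σ w y) (sonicQuot d ℓ r σ w y))
      (gapRate d ℓ r (w x) (depth σ w x) (sonicQuot d ℓ r σ w x) / sonicGap σ w x) x := by
  have hD := h.sonicGap_pos hA hx
  have hw := h.hasDerivAt_w hA hx
  have hV := h.hasDerivAt_depth hA hx
  have hT := h.hasDerivAt_sonicQuot hA hx
  have h1 := ((hw.const_sub 1).add ((hw.const_mul d).sub_const (ℓ * (r - 1)))).sub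
    (((hw.const_sub 1).add (((hw.const_sub 1).add hV).div_const ℓ)).mul hT)
  unfold gap excess
  refine h1.congr_deriv ?_
  simp only [Pi.add_apply]
  have hσ : σ x = 1 - w x + depth σ w x := by unfold depth; ring
  have hD' : depth σ w x * (2 * (1 - w x) + depth σ w x) = sonicGap σ w x := rfl
  unfold gapRate
  rw [hσ, hD']
  field_simp
  ring

/-- The lower bound on `H`, by comparison with a level that the flow can only cross upwards. -/
theorem le_gap {c : ℝ} (hcW : c ≤ (1 - wP2 d ℓ r) / 2)
    (hc : ∀ w V T, w ≤ wP2 d ℓ r → 0 ≤ V → 0 ≤ excess d ℓ r w → 0 ≤ T →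
      quadQ d ℓ r w = T * (V * (2 * (1 - w) + V)) → gap d ℓ r w V T = c →
      0 < gapRate d ℓ r w V T) {x : ℝ} (hx : x < x₂) :
    c ≤ gap d ℓ r (w x) (depth σ w x) (sonicQuot d ℓ r σ w x) := by
  obtain ⟨x₀, hx₀, hx₀x⟩ := ((h.tendsto_depth.eventually_gt_atTop
    (Admissible.farBound d ℓ (wP2 d ℓ r) κ)).and (eventually_le_atBot x)).exists
  have hstart : c ≤ gap d ℓ r (w x₀) (depth σ w x₀) (sonicQuot d ℓ r σ w x₀) := by
    have hx₀' : x₀ < x₂ := hx₀x.trans_lt hx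
    have := hA.lt_gap_of_far (h.depth_pos_and_w_lt hA x₀ hx₀').2.le (h.excess_nonneg hA hx₀')
      (h.sonicQuot_pos hA hx₀').le (h.quadQ_eq_sonicQuot_mul hA hx₀') hx₀
    linarith
  have hlt : ∀ y ∈ Icc x₀ x, y < x₂ := fun y hy => hy.2.trans_lt hx
  have := image_le_of_deriv_right_lt_deriv_boundary (a := x₀) (b := x)
    (f := fun y => -gap d ℓ r (w y) (depth σ w y) (sonicQuot d ℓ r σ w y))
    (f' := fun y => -(gapRate d ℓ r (w y) (depth σ w y) (sonicQuot d ℓ r σ w y) / sonicGap σ w y))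
    (B := fun _ => -c) (B' := fun _ => 0)
    (fun y hy => (h.hasDerivAt_gap hA (hlt y hy)).neg.continuousAt.continuousWithinAt)
    (fun y hy => (h.hasDerivAt_gap hA (hlt y ⟨hy.1, hy.2.le⟩)).neg.hasDerivWithinAt)
    (neg_le_neg hstart) (fun y => hasDerivAt_const y _)
    (fun y hy hgap => by
      have hy' := hlt y ⟨hy.1, hy.2.le⟩
      obtain ⟨h1, h2⟩ := h.depth_pos_and_w_lt hA y hy'
      have h3 := hc _ _ _ h2.le h1.le (h.excess_nonneg hA hy') (h.sonicQuot_pos hA hy').le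
        (h.quadQ_eq_sonicQuot_mul hA hy') (neg_injective hgap)
      exact neg_neg_of_pos (div_pos h3 (h.sonicGap_pos hA hy')))
    ⟨hx₀x, le_rfl⟩
  exact neg_le_neg_iff.1 this

/-- `σ² - (1 - w)²` vanishes at most linearly at the endpoint, its derivative being bounded below
near it. -/
theorem exists_sonicGap_le : ∃ K, ∃ x₁ < x₂, ∀ x ∈ Ioo x₁ x₂,
    sonicGap σ w x ≤ K * (x₂ - x) := by
  have hw := h.tendsto_w_end
  have hσ := h.tendsto_σ_end
  let R : ℝ → ℝ := fun x => 2 * σ x ^ 2 + 2 * (1 - w x) * excess d ℓ r (w x)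
  have hR : Tendsto R (𝓝[<] x₂) (𝓝 (2 * (1 - wP2 d ℓ r) ^ 2 +
      2 * (1 - wP2 d ℓ r) * excess d ℓ r (wP2 d ℓ r))) :=
    ((hσ.pow 2).const_mul 2).add (((hw.const_sub 1).const_mul 2).mul
      ((hw.const_mul d).sub_const _))
  generalize 2 * (1 - wP2 d ℓ r) ^ 2 + 2 * (1 - wP2 d ℓ r) * excess d ℓ r (wP2 d ℓ r) = K₀ at hR
  obtain ⟨x₁, hx₁, hsub⟩ := (mem_nhdsLT_iff_exists_Ioo_subset' (sub_one_lt x₂)).1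
    (hR.eventually_le_const (lt_add_one K₀))
  refine ⟨K₀ + 1, x₁, hx₁, fun x hx => ?_⟩
  have hcont : ContinuousOn (sonicGap σ w) (Icc x x₂) := by
    intro y hy
    rcases hy.2.eq_or_lt with rfl | hy'
    · have h1 := h.continuousWithinAt_w.mono (Icc_subset_Iic_self (a := x))
      have h2 := h.continuousWithinAt_σ.mono (Icc_subset_Iic_self (a := x))
      have h3 := (h2.add h1).sub (continuousWithinAt_const (b := (1 : ℝ)))
      exact h3.mul (((continuousWithinAt_const.sub h1).const_smul (2 : ℝ)).add h3)
    · exact (h.hasDerivAt_sonicGap hA hy').continuousAt.continuousWithinAt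
  have hend : sonicGap σ w x₂ = 0 := by
    unfold sonicGap depth
    rw [h.σ_end, h.w_end]
    unfold sigmaP2
    ring
  have := (convex_Icc x x₂).mul_sub_le_image_sub_of_le_deriv hcont (C := -(K₀ + 1))
    (by
      rw [interior_Icc]
      exact fun y hy => (h.hasDerivAt_sonicGap hA hy.2).differentiableAt.differentiableWithinAt)
    (by
      rw [interior_Icc]
      intro y hy
      rw [(h.hasDerivAt_sonicGap hA hy.2).deriv]
      have h1 : R y ≤ K₀ + 1 := hsub ⟨hx.1.trans hy.1, hy.2⟩
      have hT := h.sonicQuot_pos hA hy.2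
      have hℓ := hA.hℓ
      refine (neg_le_neg h1).trans ?_
      have hσy : σ y = 1 - w y + depth σ w y := by unfold depth; ring
      have h2 : sonicRate d ℓ r (w y) (depth σ w y) (sonicQuot d ℓ r σ w y) - -R y =
          2 * sonicQuot d ℓ r σ w y * (σ y ^ 2 / ℓ + (1 - w y) ^ 2) := by
        simp only [R]
        unfold sonicRate wVel
        rw [← hσy]
        ring
      have h3 : 0 ≤ 2 * sonicQuot d ℓ r σ w y * (σ y ^ 2 / ℓ + (1 - w y) ^ 2) := by positivity
      linarith)
    x ⟨le_rfl, hx.2.le⟩ x₂ ⟨hx.2.le, le_rfl⟩ hx.2.le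
  rw [hend] at this
  linarith

/-- The sonic quotient has a limit at `P₂`; this is the regularity of the trajectory at its
endpoint. -/
theorem exists_tendsto_sonicQuot {c : ℝ} (hc0 : 0 ≤ c)
    (hc : ∀ x < x₂, c ≤ gap d ℓ r (w x) (depth σ w x) (sonicQuot d ℓ r σ w x)) :
    ∃ τ, 0 < τ ∧ Tendsto (sonicQuot d ℓ r σ w) (𝓝[<] x₂) (𝓝 τ) := by
  have hw := h.tendsto_w_end
  have hσ := h.tendsto_σ_end
  have hℓ := hA.hℓ
  have hU : 0 < 1 - wP2 d ℓ r := by linarith [hA.W_lt]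
  have hex : Tendsto (fun x => excess d ℓ r (w x)) (𝓝[<] x₂) (𝓝 (excess d ℓ r (wP2 d ℓ r))) :=
    (hw.const_mul d).sub_const _
  have hq' : Tendsto (fun x => 2 * (d - 1) * w x - (ℓ * (r - 1) + d - r)) (𝓝[<] x₂)
      (𝓝 (2 * (d - 1) * wP2 d ℓ r - (ℓ * (r - 1) + d - r))) :=
    (hw.const_mul _).sub_const _
  have hCpos : 0 < -((2 * (d - 1) * wP2 d ℓ r - (ℓ * (r - 1) + d - r)) *
      excess d ℓ r (wP2 d ℓ r)) := by
    rw [hA.quadQ_deriv_eq]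
    have := mul_pos hA.hκ hA.excess_pos
    linarith
  have hApos : 0 < 2 * ((1 - wP2 d ℓ r) ^ 2 / ℓ + (1 - wP2 d ℓ r) ^ 2) := by positivity
  obtain ⟨τ, hτ, hroot⟩ := exists_pos_root (B := -((2 * (d - 1) * wP2 d ℓ r -
    (ℓ * (r - 1) + d - r)) * (1 - wP2 d ℓ r) + 2 * ((1 - wP2 d ℓ r) ^ 2 +
      (1 - wP2 d ℓ r) * excess d ℓ r (wP2 d ℓ r)))) hApos hCpos
  obtain ⟨K, x₁, hx₁, hK⟩ := h.exists_sonicGap_le hA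
  refine ⟨τ, hτ, tendsto_pos_root (M := (1 + excess d ℓ r (wP2 d ℓ r)) / (1 - wP2 d ℓ r)) hx₁ hApos hCpos hτ hroot
    (fun x hx => h.hasDerivAt_sonicQuot hA hx.2) ?_ (fun x hx => (h.sonicQuot_pos hA hx.2).le) ?_
    (fun x hx => h.sonicGap_pos hA hx.2) hK
    ((((hσ.pow 2).div_const ℓ).add ((hw.const_sub 1).pow 2)).const_mul 2)
    (((hq'.mul (hw.const_sub 1)).add (((hσ.pow 2).add ((hw.const_sub 1).mul hex)).const_mul 2)).neg)
    ((hq'.mul hex).neg)⟩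
  · intro x hx
    have hD := h.sonicGap_pos hA hx.2
    have hσx : σ x = 1 - w x + depth σ w x := by unfold depth; ring
    rw [div_mul_cancel₀ _ hD.ne']
    unfold quotRate sonicRate wVel
    rw [← hσx]
    ring
  · intro x hx
    obtain ⟨h1, h2⟩ := h.depth_pos_and_w_lt hA x hx.2
    exact hA.quot_le h2.le h1.le (h.excess_nonneg hA hx.2) (h.sonicQuot_pos hA hx.2).le
      (hc0.trans (hc x hx.2))

end

end IsP6P2Trajectory

/-- A lower bound on `H`, together with `F = σ T / ℓ ≥ 0` and `1 - w ≤ σ`, gives the three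
inequalities, since `1 - w - w' = H + F`. -/
theorem repulsivity_of_gap {d ℓ r c w V T : ℝ} (hℓ : 0 < ℓ) (hw : w < 1) (hV : 0 ≤ V)
    (hT : 0 ≤ T) (hc : 0 < c) (hgap : c ≤ gap d ℓ r w V T) :
    min c (c ^ 2) ≤ (1 - w - wVel d ℓ r w T) ^ 2 -
        ((1 - w + V) + (1 - w + V) * (T / ℓ - 1)) ^ 2 ∧
      min c (c ^ 2) ≤ 1 - w - wVel d ℓ r w T -
        (1 - w) * ((1 - w + V) + (1 - w + V) * (T / ℓ - 1)) / (1 - w + V) ∧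
      min c (c ^ 2) ≤ 1 - w - wVel d ℓ r w T := by
  have hu : 0 < 1 - w := by linarith
  have hσ : 0 < 1 - w + V := by linarith
  obtain ⟨F, hF⟩ : ∃ F, F = (1 - w + V) * (T / ℓ) := ⟨_, rfl⟩
  have hF0 : 0 ≤ F := by rw [hF]; positivity
  have e1 : (1 - w + V) + (1 - w + V) * (T / ℓ - 1) = F := by rw [hF]; ring
  have e2 : 1 - w - wVel d ℓ r w T = gap d ℓ r w V T + F := by
    rw [hF]; unfold gap wVel; ring
  have e3 : (1 - w) * F / (1 - w + V) ≤ F := by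
    rw [div_le_iff₀ hσ]; nlinarith
  rw [e1, e2]
  refine ⟨(min_le_right _ _).trans ?_, (min_le_left _ _).trans ?_, (min_le_left _ _).trans ?_⟩
  · nlinarith [mul_nonneg hc.le hF0]
  · linarith
  · linarith

end

theorem lemma1p5 (d : ℕ) (hd : 2 ≤ d) (ℓ : ℝ) (hℓ : 0 < ℓ)
    (hrange : ℓ < d ∨ ((d : ℝ) < ℓ ∧ (d = 2 ∨ d = 3))) :
    ∃ ε : ℝ, 0 < ε ∧ ∀ r : ℝ, rInf d ℓ - ε < r → r < rInf d ℓ →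
      ∃ c : ℝ, 0 < c ∧ ∀ (σ w : ℝ → ℝ) (x₂ : ℝ), IsP6P2Trajectory d ℓ r σ w x₂ →
        ∀ x ≤ x₂, ∃ σ' w' F : ℝ,
          HasDerivWithinAt σ σ' (Iic x₂) x ∧ HasDerivWithinAt w w' (Iic x₂) x ∧
          F = σ x + σ' ∧
          c ≤ (1 - w x - w') ^ 2 - F ^ 2 ∧
          c ≤ 1 - w x - w' - (1 - w x) * F / σ x ∧
          c ≤ 1 - w x - w' := by
  have hd2 : (2 : ℝ) ≤ d := by exact_mod_cast hd
  -- With this `ε` the condition on `r` is `1 < r < r_∞`.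
  refine ⟨rInf d ℓ - 1, sub_pos.2 (one_lt_rInf (by linarith) hℓ), fun r hr hrI => ?_⟩
  rw [sub_sub_cancel] at hr
  have hA : Admissible d ℓ r (wP2 d ℓ r) √(discJ d ℓ r) := by
    unfold rInf at hrI
    split_ifs at hrI with hlt
    · exact admissible_of_lt_rStar hd2 hℓ hr hrI
    · exact admissible_of_lt_rPlus hd2 (hrange.resolve_left hlt).1 hr hrI
  obtain ⟨c, hc, hcW, hlevel⟩ := hA.exists_gap_level
  -- The first inequality is quadratic in `H`, the other two are linear.
  refine ⟨min c (c ^ 2), by positivity, fun σ w x₂ h x hx => ?_⟩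
  have hgap := fun y (hy : y < x₂) => h.le_gap hA hcW hlevel hy
  rcases hx.lt_or_eq with hlt | rfl
  · obtain ⟨h1, h2⟩ := h.depth_pos_and_w_lt hA x hlt
    have hσx : σ x = 1 - w x + depth σ w x := by unfold depth; ring
    refine ⟨_, _, _, (h.hasDerivAt_σ hA hlt).hasDerivWithinAt,
      (h.hasDerivAt_w hA hlt).hasDerivWithinAt, rfl, ?_⟩
    rw [hσx]
    exact repulsivity_of_gap hℓ (h2.trans hA.W_lt) h1.le (h.sonicQuot_pos hA hlt).le hc (hgap x hlt)
  · obtain ⟨τ, hτ, hlim⟩ := h.exists_tendsto_sonicQuot hA hc.le hgap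
    have hw := h.tendsto_w_end
    have hσ := h.tendsto_σ_end
    have hσ' : HasDerivWithinAt σ ((1 - wP2 d ℓ r) * (τ / ℓ - 1)) (Iic x) x := by
      refine hasDerivWithinAt_Iic_of_tendsto_deriv (s := Iio x)
        (fun y hy => (h.differentiableAt_σ y hy).differentiableWithinAt)
        (h.continuousWithinAt_σ.mono Iio_subset_Iic_self) self_mem_nhdsWithin ?_
      refine (hσ.mul ((hlim.div_const ℓ).sub_const 1)).congr' ?_
      filter_upwards [self_mem_nhdsWithin] with y hy
      exact (h.hasDerivAt_σ hA hy).deriv.symm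
    have hw' : HasDerivWithinAt w (wVel d ℓ r (wP2 d ℓ r) τ) (Iic x) x := by
      refine hasDerivWithinAt_Iic_of_tendsto_deriv (s := Iio x)
        (fun y hy => (h.differentiableAt_w y hy).differentiableWithinAt)
        (h.continuousWithinAt_w.mono Iio_subset_Iic_self) self_mem_nhdsWithin ?_
      have : Tendsto (fun y => wVel d ℓ r (w y) (sonicQuot d ℓ r σ w y)) (𝓝[<] x)
          (𝓝 (wVel d ℓ r (wP2 d ℓ r) τ)) :=
        ((hw.const_mul _).sub_const _).neg.add ((hw.const_sub 1).mul hlim)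
      refine this.congr' ?_
      filter_upwards [self_mem_nhdsWithin] with y hy
      exact (h.hasDerivAt_w hA hy).deriv.symm
    have hV : Tendsto (depth σ w) (𝓝[<] x) (𝓝 0) := by
      have := (hσ.add hw).sub_const 1
      rwa [sub_add_cancel, sub_self] at this
    have hend : c ≤ gap d ℓ r (wP2 d ℓ r) 0 τ := by
      have hcont : Continuous fun p : ℝ × ℝ × ℝ => gap d ℓ r p.1 p.2.1 p.2.2 := by
        unfold gap excess; fun_prop
      refine ge_of_tendsto ((hcont.tendsto (wP2 d ℓ r, 0, τ)).comp
        (hw.prodMk_nhds (hV.prodMk_nhds hlim))) ?_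
      filter_upwards [self_mem_nhdsWithin] with y hy using hgap y hy
    have := repulsivity_of_gap hℓ hA.W_lt le_rfl hτ.le hc hend
    rw [add_zero] at this
    refine ⟨_, _, _, hσ', hw', rfl, ?_⟩
    rw [h.σ_end, h.w_end]
    exact this
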